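/- Let $n,d\in\mathbb N$, let $V\subset\mathbb R^n$ be open, and let $A$ be a locally Lipschitz map from $V$ to the set of real symmetric positive definite $d\times d$ matrices. For such a matrix $M=Q\,\mathrm{diag}(t_1,\dots,t_d)\,Q^T$ with $Q$ orthogonal, put $M^\lambda=Q\,\mathrm{diag}(t_1^\lambda,\dots,t_d^\lambda)\,Q^T$ $(\lambda\in\mathbb R)$ and $\log M=Q\,\mathrm{diag}(\log t_1,\dots,\log t_d)\,Q^T$. Then there is a Lebesgue null set $N\subset V$ such that at every $x\in V\setminus N$ the maps $\log A$ and $A^\lambda$, for all $\lambda\in\mathbb R$, are differentiable, and the $n\times d\times d$ tensors $\mathcal D^\lambda A=(\mathcal D^\lambda_iA)_{i=1}^n$ with $$\mathcal D^\lambda_iA=\lambda^{-1}\,\partial_i(A^\lambda)\quad(\lambda\neq0),\qquad \mathcal D^0_iA=\partial_i(\log A)$$ satisfy at $x$, for all $\alpha,\beta\in\mathbb R$, $$\langle\mathcal D^\alpha A,\mathcal D^\beta A\rangle\ \ge\ \bigl|\mathcal D^{\frac{\alpha+\beta}2}A\bigr|^2,$$ where $\langle X,Y\rangle=\sum_{i=1}^n\sum_{j,k=1}^dX_{ijk}Y_{ijk}$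 and $|X|=\sqrt{\langle X,X\rangle}$. (This is a strengthened form of logarithmic convexity of the function $\lambda\mapsto|\mathcal D^\lambda A|$ at almost every point of $V$.) -/

import Mathlib

open MeasureTheory

noncomputable section

/-- The real power `M ^ s` of a symmetric positive definite matrix, through the functional calculus
of symmetric matrices: `Q diag(t₁ ^ s, …, t_d ^ s) Qᵀ` if `M = Q diag(t₁, …, t_d) Qᵀ`. -/
def matPow {d : ℕ} (s : ℝ) (M : Matrix (Fin d) (Fin d) ℝ) : Matrix (Fin d) (Fin d) ℝ :=
  cfc (fun t : ℝ => t ^ s) M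

/-- The logarithm of a symmetric positive definite matrix, through the functional calculus. -/
def matLog {d : ℕ} (M : Matrix (Fin d) (Fin d) ℝ) : Matrix (Fin d) (Fin d) ℝ :=
  cfc Real.log M

/-- A matrix-valued map is locally Lipschitz on `V` (equivalently: each of its entries is). -/
def MatLocallyLipschitzOn {n d : ℕ} (V : Set (EuclideanSpace ℝ (Fin n)))
    (F : EuclideanSpace ℝ (Fin n) → Matrix (Fin d) (Fin d) ℝ) : Prop :=
  ∀ j k, LocallyLipschitzOn V (fun y => F y j k)

/-- A matrix-valued map is (Fréchet) differentiable at `x` (equivalently: each of its entries is). -/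
def MatDifferentiableAt {n d : ℕ} (F : EuclideanSpace ℝ (Fin n) → Matrix (Fin d) (Fin d) ℝ)
    (x : EuclideanSpace ℝ (Fin n)) : Prop :=
  ∀ j k, DifferentiableAt ℝ (fun y => F y j k) x

/-- The `i`-th partial derivative of a matrix-valued map, taken entry by entry. -/
def matPartial {n d : ℕ} (i : Fin n) (F : EuclideanSpace ℝ (Fin n) → Matrix (Fin d) (Fin d) ℝ)
    (x : EuclideanSpace ℝ (Fin n)) : Matrix (Fin d) (Fin d) ℝ :=
  Matrix.of fun j k => lineDeriv ℝ (fun y => F y j k) x (EuclideanSpace.single i 1)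

/-- The nonlinear operator `𝒟^s A`: the `n × d × d` tensor with the slices
`𝒟ᵢ^s A = s⁻¹ 𝒟ᵢ(A ^ s)` if `s ≠ 0`, and `𝒟ᵢ^0 A = 𝒟ᵢ(log A)`. -/
def powDeriv {n d : ℕ} (s : ℝ) (A : EuclideanSpace ℝ (Fin n) → Matrix (Fin d) (Fin d) ℝ)
    (x : EuclideanSpace ℝ (Fin n)) : Fin n → Matrix (Fin d) (Fin d) ℝ :=
  fun i => if s = 0 then matPartial i (fun y => matLog (A y)) x
    else s⁻¹ • matPartial i (fun y => matPow s (A y)) x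

/-- The Euclidean (Frobenius) inner product of `n × d × d` tensors. -/
def tensorInner {n d : ℕ} (X Y : Fin n → Matrix (Fin d) (Fin d) ℝ) : ℝ :=
  ∑ i, ∑ j, ∑ k, X i j k * Y i j k

/-- The Euclidean (Frobenius) norm of `n × d × d` tensors. -/
def tensorNorm {n d : ℕ} (X : Fin n → Matrix (Fin d) (Fin d) ℝ) : ℝ :=
  Real.sqrt (tensorInner X X)

end

open Polynomial Topology Filter RightActions
open scoped Matrix.Norms.L2Operator

/-! By Rademacher's theorem, `A` is differentiable at almost every point of `V`. At such an `x` the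
Daleckii-Krein formula `exists_hasFDerivAt_cfc` differentiates `matLog` and every `matPow s` along
`A`: in an eigenbasis of `A x`, with eigenvalues `t_j`, the `(j, k)` entry of `𝒟ᵢ^s A` is that of
`∂ᵢA` times `powFactor s t_j t_k`.

The Frobenius product is invariant under orthogonal conjugation, so the claim follows term by term
from the scalar inequality `sq_powFactor_le`. For `a ≠ b`, `powFactor s a b` is `(a - b)⁻¹` times
the integral of `exp (s * u)` over `u` from `log b` to `log a`, and the inequality is
Cauchy-Schwarz. -/

/-- The divided difference of `f` at `a, b`, equal to `f' a` on the diagonal. -/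
noncomputable def dividedDiff (f f' : ℝ → ℝ) (a b : ℝ) : ℝ :=
  if a = b then f' a else (f a - f b) / (a - b)

/-- Hermite interpolation of values and first derivatives on a finite set. -/
theorem exists_polynomial_hermite (s : Finset ℝ) (f f' : ℝ → ℝ) :
    ∃ p : ℝ[X], ∀ t ∈ s, p.eval t = f t ∧ p.derivative.eval t = f' t := by
  have hinj : Set.InjOn (id : ℝ → ℝ) s := Function.injective_id.injOn
  let l := Lagrange.interpolate s id f
  let N := Lagrange.nodal s (id : ℝ → ℝ)
  have hN : ∀ t ∈ s, N.derivative.eval t ≠ 0 := fun t ht h => by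
    have h1 := Lagrange.nodalWeight_ne_zero hinj ht
    rw [Lagrange.nodalWeight_eq_eval_derivative_nodal ht] at h1
    simp only [id] at h1
    exact h1 (by rw [show eval t (derivative (Lagrange.nodal s id)) = 0 from h, inv_zero])
  -- `N` vanishes on `s`, so adding `N * q` keeps the values of `l` there and changes its derivative
  -- by `N' * q`.
  let q := Lagrange.interpolate s id fun t => (f' t - l.derivative.eval t) / N.derivative.eval t
  refine ⟨l + N * q, fun t ht => ?_⟩
  have h0 : N.eval t = 0 := Lagrange.eval_nodal_at_node (v := id) ht
  have hl : l.eval t = f t := Lagrange.eval_interpolate_at_node f hinj ht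
  have hq : q.eval t = (f' t - l.derivative.eval t) / N.derivative.eval t :=
    Lagrange.eval_interpolate_at_node _ hinj ht
  refine ⟨by simp [h0, hl], ?_⟩
  simp only [derivative_add, derivative_mul, eval_add, eval_mul, h0, hq, zero_mul, add_zero]
  field_simp [hN t ht]
  ring

namespace Matrix

/-! ### Spectral perturbation and the Daleckii-Krein formula -/

variable {d : ℕ} {A B : Matrix (Fin d) (Fin d) ℝ}

theorem IsHermitian.cfc_eq_mul_diagonal (hA : A.IsHermitian) (f : ℝ → ℝ) :
    cfc f A = (hA.eigenvectorUnitary : Matrix (Fin d) (Fin d) ℝ) *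
      diagonal (fun i => f (hA.eigenvalues i)) *
        star (hA.eigenvectorUnitary : Matrix (Fin d) (Fin d) ℝ) := by
  rw [hA.cfc_eq, IsHermitian.cfc, Unitary.conjStarAlgAut_apply]
  rfl

theorem norm_unitary_conj (U : unitary (Matrix (Fin d) (Fin d) ℝ))
    (M : Matrix (Fin d) (Fin d) ℝ) :
    ‖(U : Matrix (Fin d) (Fin d) ℝ) * M * star (U : Matrix (Fin d) (Fin d) ℝ)‖ = ‖M‖ := by
  rw [← Unitary.coe_star, CStarRing.norm_mul_coe_unitary, CStarRing.norm_coe_unitary_mul]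

theorem IsHermitian.norm_cfc_le (hA : A.IsHermitian) (f : ℝ → ℝ) {c : ℝ} (hc : 0 ≤ c)
    (h : ∀ i, |f (hA.eigenvalues i)| ≤ c) : ‖cfc f A‖ ≤ c := by
  rw [hA.cfc_eq_mul_diagonal, norm_unitary_conj, l2_opNorm_diagonal]
  exact (pi_norm_le_iff_of_nonneg hc).2 h

/-- Every eigenvalue of `B` lies within `‖B - A‖` of the spectrum of `A`. -/
theorem IsHermitian.exists_abs_eigenvalues_sub_le (hA : A.IsHermitian) (hB : B.IsHermitian)
    (l : Fin d) : ∃ k, |hB.eigenvalues l - hA.eigenvalues k| ≤ ‖B - A‖ := by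
  by_contra! h
  set μ := hB.eigenvalues l with hμ
  set U : Matrix (Fin d) (Fin d) ℝ := hA.eigenvectorUnitary.1 with hU
  have hUU : star U * U = 1 := Unitary.coe_star_mul_self hA.eigenvectorUnitary
  have hUU' : U * star U = 1 := Unitary.coe_mul_star_self hA.eigenvectorUnitary
  have hne : ∀ k, hA.eigenvalues k - μ ≠ 0 := fun k h0 => by
    have := h k
    rw [abs_sub_comm, h0, abs_zero] at this
    exact absurd this (not_lt.2 (norm_nonneg _))
  have hAs : A = U * diagonal hA.eigenvalues * star U := by
    conv_lhs => rw [hA.spectral_theorem, Unitary.conjStarAlgAut_apply]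
    rfl
  -- The resolvent of `A` at `μ`. If `B ≠ A`, then `h` gives `‖R‖ < ‖B - A‖⁻¹`, so `‖R * (A - B)‖ <
  -- 1`. But `(A - μ) v = (A - B) v` for the eigenvector `v` of `B`, so `R * (A - B)` fixes `v`.
  set R := U * diagonal (fun k => (hA.eigenvalues k - μ)⁻¹) * star U with hR
  have hRA : R * (A - μ • 1) = 1 := by
    have h1 : A - μ • 1 = U * diagonal (fun k => hA.eigenvalues k - μ) * star U := by
      have h2 : diagonal (fun k => hA.eigenvalues k - μ) = diagonal hA.eigenvalues - μ • 1 := by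
        rw [← diagonal_one, ← diagonal_smul, diagonal_sub]
        simp
      rw [h2, mul_sub, sub_mul, ← hAs]
      simp [hUU']
    rw [h1, hR, show ∀ X Y : Matrix (Fin d) (Fin d) ℝ,
      U * X * star U * (U * Y * star U) = U * (X * (star U * U) * Y) * star U by
        intros; noncomm_ring, hUU, mul_one, diagonal_mul_diagonal]
    simp [hne, hUU']
  have hv := hB.mulVec_eigenvectorBasis l
  set v := hB.eigenvectorBasis l with hvdef
  have hv1 : ‖v‖ = 1 := hB.eigenvectorBasis.orthonormal.1 l
  have hfix : (R * (A - B)) *ᵥ ⇑v = ⇑v := by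
    have h3 : (A - B) *ᵥ ⇑v = (A - μ • 1) *ᵥ ⇑v := by
      rw [sub_mulVec, sub_mulVec, hv, smul_mulVec, one_mulVec]
    rw [← mulVec_mulVec, h3, mulVec_mulVec, hRA, one_mulVec]
  have hle : (1 : ℝ) ≤ ‖R * (A - B)‖ := by
    have := l2_opNorm_mulVec (R * (A - B)) v
    rw [hfix, hv1, mul_one] at this
    calc (1 : ℝ) = ‖v‖ := hv1.symm
      _ ≤ _ := this
  have hlt : ‖R * (A - B)‖ < 1 := by
    rcases eq_or_ne ‖B - A‖ 0 with h0 | h0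
    · have : A - B = 0 := by rw [← neg_sub, norm_eq_zero.1 h0, neg_zero]
      simp [this]
    have hpos : 0 < ‖B - A‖ := lt_of_le_of_ne (norm_nonneg _) (Ne.symm h0)
    have hRn : ‖R‖ < ‖B - A‖⁻¹ := by
      rw [hR, hU, norm_unitary_conj, l2_opNorm_diagonal, pi_norm_lt_iff (inv_pos.2 hpos)]
      intro k
      rw [norm_inv, Real.norm_eq_abs, abs_sub_comm]
      exact inv_strictAnti₀ hpos (h k)
    calc ‖R * (A - B)‖ ≤ ‖R‖ * ‖B - A‖ := by
          rw [norm_sub_rev B A]; exact norm_mul_le _ _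
      _ < ‖B - A‖⁻¹ * ‖B - A‖ := by gcongr
      _ = 1 := inv_mul_cancel₀ h0
  exact absurd hle (not_le.2 hlt)

theorem IsHermitian.cfc_polynomial (hA : A.IsHermitian) (p : ℝ[X]) :
    cfc (fun t => p.eval t) A = aeval A p :=
  _root_.cfc_polynomial p A hA

theorem IsHermitian.cfc_sub_polynomial (hA : A.IsHermitian) (f : ℝ → ℝ) (p : ℝ[X]) :
    cfc (fun t => f t - p.eval t) A = cfc f A - aeval A p := by
  rw [← hA.cfc_polynomial, hA.cfc_eq_mul_diagonal, hA.cfc_eq_mul_diagonal f,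
    hA.cfc_eq_mul_diagonal fun t => p.eval t, ← sub_mul, ← mul_sub, diagonal_sub]

variable {E : Type*} [NormedAddCommGroup E] [NormedSpace ℝ E]
  {F : E → Matrix (Fin d) (Fin d) ℝ} {F' : E →L[ℝ] Matrix (Fin d) (Fin d) ℝ} {x : E}

/-- A function vanishing to first order on the spectrum of `F x` produces a map with derivative
zero at `x`. -/
theorem hasFDerivAt_cfc_zero (hF : HasFDerivAt F F' x)
    (hherm : ∀ᶠ y in 𝓝 x, (F y).IsHermitian) (hx : (F x).IsHermitian) {g : ℝ → ℝ}
    (hg0 : ∀ i, g (hx.eigenvalues i) = 0) (hg : ∀ i, HasDerivAt g 0 (hx.eigenvalues i)) :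
    HasFDerivAt (fun y => cfc g (F y)) (0 : E →L[ℝ] Matrix (Fin d) (Fin d) ℝ) x := by
  have hx0 : cfc g (F x) = 0 := by
    rw [hx.cfc_eq_mul_diagonal]; simp [hg0]
  -- The eigenvalues of `F y` lie within `‖F y - F x‖` of those of `F x`, where `g` vanishes to
  -- first order, and `|g|` on them bounds `‖cfc g (F y)‖`.
  have key : (fun y => cfc g (F y)) =o[𝓝 x] fun y => F y - F x := by
    rw [Asymptotics.isLittleO_iff]
    intro c hc
    have h1 : ∀ i, ∀ᶠ r in 𝓝 (0 : ℝ), ∀ t, |t - hx.eigenvalues i| ≤ r →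
        |g t| ≤ c * |t - hx.eigenvalues i| := fun i => by
      have h2 := (hasDerivAt_iff_isLittleO.1 (hg i)).def hc
      obtain ⟨δ, hδ, h3⟩ := Metric.eventually_nhds_iff.1 h2
      filter_upwards [Iio_mem_nhds hδ] with r hr t ht
      have := h3 (show dist t (hx.eigenvalues i) < δ by
        rw [Real.dist_eq]; exact ht.trans_lt hr)
      simpa [hg0 i] using this
    have h4 : Tendsto (fun y => ‖F y - F x‖) (𝓝 x) (𝓝 0) := by
      have : Tendsto (fun y => F y - F x) (𝓝 x) (𝓝 (F x - F x)) :=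
        hF.continuousAt.sub continuousAt_const
      simpa using this.norm
    filter_upwards [h4.eventually (eventually_all.2 h1), hherm] with y hy hyh
    refine hyh.norm_cfc_le g (by positivity) fun l => ?_
    obtain ⟨k, hk⟩ := hx.exists_abs_eigenvalues_sub_le hyh l
    exact (hy k _ hk).trans (by gcongr)
  rw [hasFDerivAt_iff_isLittleO]
  simpa [hx0] using key.trans_isBigO hF.isBigO_sub

/-- By linearity monomials suffice. In the eigenbasis the product rule for `X ^ n * X` becomes the
recursion of divided differences: that of `t ^ (n + 1)` at `a, b` is `a ^ n` plus `b` times that of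
`t ^ n`. -/
theorem exists_hasFDerivAt_aeval (hF : HasFDerivAt F F' x) (hx : (F x).IsHermitian) (p : ℝ[X]) :
    ∃ G : E →L[ℝ] Matrix (Fin d) (Fin d) ℝ, HasFDerivAt (fun y => aeval (F y) p) G x ∧
      ∀ v j k, (star (hx.eigenvectorUnitary : Matrix (Fin d) (Fin d) ℝ) * G v *
          hx.eigenvectorUnitary) j k =
        dividedDiff (fun t => p.eval t) (fun t => p.derivative.eval t) (hx.eigenvalues j)
          (hx.eigenvalues k) *
        (star (hx.eigenvectorUnitary : Matrix (Fin d) (Fin d) ℝ) * F' v *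
          hx.eigenvectorUnitary) j k := by
  set U : Matrix (Fin d) (Fin d) ℝ := hx.eigenvectorUnitary.1 with hU
  have hUU : star U * U = 1 := Unitary.coe_star_mul_self hx.eigenvectorUnitary
  have hUU' : U * star U = 1 := Unitary.coe_mul_star_self hx.eigenvectorUnitary
  have hp : ∀ q : ℝ[X], star U * aeval (F x) q =
      diagonal (fun i => q.eval (hx.eigenvalues i)) * star U := fun q => by
    rw [← hx.cfc_polynomial, hx.cfc_eq_mul_diagonal, ← hU, mul_assoc U, ← mul_assoc, hUU, one_mul]
  have hX : F x * U = U * diagonal hx.eigenvalues := by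
    conv_lhs => rw [hx.spectral_theorem, Unitary.conjStarAlgAut_apply, mul_assoc]
    rw [← hU, hUU, mul_one]
    rfl
  induction p using Polynomial.induction_on' with
  | add p q hp hq =>
    obtain ⟨G, hG, h1⟩ := hp
    obtain ⟨H, hH, h2⟩ := hq
    refine ⟨G + H, ?_, fun v j k => ?_⟩
    · simp only [map_add]
      exact hG.add hH
    have : star U * (G + H) v * U = star U * G v * U + star U * H v * U := by
      simp [mul_add, add_mul]
    rw [this, add_apply, h1, h2]
    simp only [dividedDiff, eval_add, derivative_add]
    split_ifs <;> ring
  | monomial n a =>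
    induction n with
    | zero =>
      refine ⟨0, by simpa using hasFDerivAt_const _ _, fun v j k => ?_⟩
      simp [dividedDiff]
    | succ n ih =>
      obtain ⟨G, hG, h1⟩ := ih
      have hm := hG.mul' hF
      refine ⟨_, hm.congr_of_eventuallyEq (Eventually.of_forall fun y => ?_), fun v j k => ?_⟩
      · simp [aeval_monomial, pow_succ, mul_assoc]
      · have e1 : star U * ((aeval (F x) (monomial n a)) * F' v + G v * F x) * U =
            diagonal (fun i => (monomial n a).eval (hx.eigenvalues i)) * (star U * F' v * U) +
              (star U * G v * U) * diagonal hx.eigenvalues := by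
          rw [mul_add, add_mul, ← mul_assoc, hp, mul_assoc (star U), mul_assoc (G v), hX]
          simp only [mul_assoc]
        have e2 : ((aeval (F x) (monomial n a)) • F' + G <• F x) v =
          (aeval (F x) (monomial n a)) * F' v + G v * F x := rfl
        erw [e2]
        rw [e1, add_apply, diagonal_mul, mul_diagonal, h1]
        simp only [dividedDiff, eval_monomial, derivative_monomial]
        split_ifs with hjk
        · rw [hjk]
          -- `derivative_monomial` carries the truncated exponent `n - 1`.
          rcases n with _ | n
          · simp
          · simp; ring
        · have := sub_ne_zero.2 hjk
          field_simp
          ring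

/-- The Daleckii-Krein formula. -/
theorem exists_hasFDerivAt_cfc (hF : HasFDerivAt F F' x)
    (hherm : ∀ᶠ y in 𝓝 x, (F y).IsHermitian) (hx : (F x).IsHermitian) {f f' : ℝ → ℝ}
    (hf : ∀ i, HasDerivAt f (f' (hx.eigenvalues i)) (hx.eigenvalues i)) :
    ∃ G : E →L[ℝ] Matrix (Fin d) (Fin d) ℝ, HasFDerivAt (fun y => cfc f (F y)) G x ∧
      ∀ v j k, (star (hx.eigenvectorUnitary : Matrix (Fin d) (Fin d) ℝ) * G v *
          hx.eigenvectorUnitary) j k =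
        dividedDiff f f' (hx.eigenvalues j) (hx.eigenvalues k) *
        (star (hx.eigenvectorUnitary : Matrix (Fin d) (Fin d) ℝ) * F' v *
          hx.eigenvectorUnitary) j k := by
  -- With `p` matching `f` and `f'` on the spectrum of `F x`, the remainder `f - p` contributes
  -- derivative zero. Multiple eigenvalues need no special care.
  obtain ⟨p, hp⟩ := exists_polynomial_hermite (Finset.univ.image hx.eigenvalues) f f'
  simp only [Finset.mem_image, Finset.mem_univ, true_and, forall_exists_index,
    forall_apply_eq_imp_iff] at hp
  obtain ⟨G, hG, h⟩ := exists_hasFDerivAt_aeval hF hx p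
  have hz := hasFDerivAt_cfc_zero hF hherm hx (g := fun t => f t - p.eval t)
    (fun i => by simp [(hp i).1]) fun i => by
      have := (hf i).sub (p.hasDerivAt (hx.eigenvalues i))
      rw [(hp i).2, sub_self] at this
      exact this
  refine ⟨G, ?_, fun v j k => ?_⟩
  · have := hz.add hG
    rw [zero_add] at this
    refine this.congr_of_eventuallyEq ?_
    filter_upwards [hherm] with y hy
    simp [hy.cfc_sub_polynomial]
  · rw [h]
    simp only [dividedDiff, (hp _).1, (hp _).2]

end Matrix

open Topology Filter

/-! ### The scalar inequality -/

theorem integral_exp_mul_eq (s p q : ℝ) (hs : s ≠ 0) :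
    ∫ u in q..p, Real.exp (s * u) = (Real.exp (s * p) - Real.exp (s * q)) / s := by
  rw [intervalIntegral.integral_comp_mul_left (fun u => Real.exp u) hs, integral_exp, smul_eq_mul]
  field_simp

/-- Cauchy-Schwarz for exponentials. -/
theorem sq_integral_exp_le {p q : ℝ} (hqp : q ≤ p) (α β : ℝ) :
    (∫ u in q..p, Real.exp ((α + β) / 2 * u)) ^ 2 ≤
      (∫ u in q..p, Real.exp (α * u)) * ∫ u in q..p, Real.exp (β * u) := by
  have hi : ∀ s : ℝ, IntervalIntegrable (fun u => Real.exp (s * u)) volume q p := fun s =>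
    Continuous.intervalIntegrable (by fun_prop) _ _
  -- The quadratic in `t` is the integral of a square, so its discriminant is nonpositive.
  have key : ∀ t : ℝ, 0 ≤ (∫ u in q..p, Real.exp (β * u)) * (t * t) +
      (-2 * ∫ u in q..p, Real.exp ((α + β) / 2 * u)) * t + ∫ u in q..p, Real.exp (α * u) := by
    intro t
    have h : 0 ≤ ∫ u in q..p, (t * Real.exp (β / 2 * u) - Real.exp (α / 2 * u)) ^ 2 :=
      intervalIntegral.integral_nonneg hqp fun u _ => sq_nonneg _
    have e : ∀ u : ℝ, (t * Real.exp (β / 2 * u) - Real.exp (α / 2 * u)) ^ 2 =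
        (t * t) * Real.exp (β * u) + (-2 * t) * Real.exp ((α + β) / 2 * u) +
          Real.exp (α * u) := fun u => by
      have e1 : Real.exp (β * u) = Real.exp (β / 2 * u) ^ 2 := by
        rw [← Real.exp_nat_mul]; congr 1; push_cast; ring
      have e2 : Real.exp (α * u) = Real.exp (α / 2 * u) ^ 2 := by
        rw [← Real.exp_nat_mul]; congr 1; push_cast; ring
      have e3 : Real.exp ((α + β) / 2 * u) = Real.exp (α / 2 * u) * Real.exp (β / 2 * u) := by
        rw [← Real.exp_add]; congr 1; ring
      rw [e1, e2, e3]; ring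
    simp only [e] at h
    rw [intervalIntegral.integral_add (((hi _).const_mul _).add ((hi _).const_mul _)) (hi _),
      intervalIntegral.integral_add ((hi _).const_mul _) ((hi _).const_mul _),
      intervalIntegral.integral_const_mul, intervalIntegral.integral_const_mul] at h
    linarith
  have := discrim_le_zero key
  rw [discrim] at this
  nlinarith

/-- The scalar factor `s⁻¹ f^{[1]}(a, b)`, `f t = t ^ s`, by which `𝒟^s` acts in an eigenbasis
(with `f = log` if `s = 0`). -/
noncomputable def powFactor (s a b : ℝ) : ℝ :=
  if s = 0 then dividedDiff Real.log (fun t => t⁻¹) a b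
  else s⁻¹ * dividedDiff (fun t => t ^ s) (fun t => s * t ^ (s - 1)) a b

theorem powFactor_self (s : ℝ) {a : ℝ} (ha : 0 < a) : powFactor s a a = a ^ (s - 1) := by
  unfold powFactor dividedDiff
  rw [if_pos rfl, if_pos rfl]
  split_ifs with hs
  · simp [hs, Real.rpow_neg_one]
  · field_simp

/-- The integral covers `s = 0` and `s ≠ 0` uniformly: at `s = 0` the integrand is `1`, which gives
the logarithm. -/
theorem powFactor_of_ne (s : ℝ) {a b : ℝ} (ha : 0 < a) (hb : 0 < b) (hab : a ≠ b) :
    powFactor s a b = (∫ u in (Real.log b)..(Real.log a), Real.exp (s * u)) / (a - b) := by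
  unfold powFactor dividedDiff
  rw [if_neg hab, if_neg hab]
  split_ifs with hs
  · simp [hs]
  · simp only [integral_exp_mul_eq _ _ _ hs, Real.rpow_def_of_pos ha, Real.rpow_def_of_pos hb,
      mul_comm (Real.log _) s]
    field_simp

theorem powFactor_comm (s a b : ℝ) : powFactor s a b = powFactor s b a := by
  have h : ∀ f f' : ℝ → ℝ, dividedDiff f f' a b = dividedDiff f f' b a := fun f f' => by
    unfold dividedDiff
    rcases eq_or_ne a b with h | h
    · rw [h]
    · rw [if_neg h, if_neg h.symm, ← neg_sub (f b), ← neg_sub b a, neg_div_neg_eq]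
  unfold powFactor
  rw [h, h]

theorem sq_powFactor_le (α β : ℝ) {a b : ℝ} (ha : 0 < a) (hb : 0 < b) :
    powFactor ((α + β) / 2) a b ^ 2 ≤ powFactor α a b * powFactor β a b := by
  wlog hab : b ≤ a generalizing a b
  · rw [powFactor_comm _ a b, powFactor_comm α a b, powFactor_comm β a b]
    exact this hb ha (le_of_not_ge hab)
  rcases hab.eq_or_lt with rfl | hlt
  · rw [powFactor_self _ ha, powFactor_self _ ha, powFactor_self _ ha, ← Real.rpow_natCast,
      ← Real.rpow_mul ha.le, ← Real.rpow_add ha]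
    exact le_of_eq (by congr 1; push_cast; ring)
  · rw [powFactor_of_ne _ ha hb hlt.ne', powFactor_of_ne _ ha hb hlt.ne',
      powFactor_of_ne _ ha hb hlt.ne', div_pow, div_mul_div_comm, ← sq]
    gcongr
    exact sq_integral_exp_le (Real.log_le_log hb hab) α β

/-! ### Almost everywhere differentiability and matrix entries -/

/-- Rademacher's theorem for locally Lipschitz functions on an open set. -/
theorem LocallyLipschitzOn.ae_differentiableAt {E : Type*} [NormedAddCommGroup E]
    [NormedSpace ℝ E] [FiniteDimensional ℝ E] [MeasurableSpace E] [BorelSpace E] {μ : Measure E}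
    [μ.IsAddHaarMeasure] {V : Set E} (hV : IsOpen V) {f : E → ℝ}
    (hf : LocallyLipschitzOn V f) : ∀ᵐ x ∂(μ.restrict V), DifferentiableAt ℝ f x := by
  rw [ae_restrict_iff' hV.measurableSet, ae_iff]
  -- Being null is a local property, and near each point of `V` the function is Lipschitz on an open
  -- set.
  refine measure_null_of_locally_null _ fun x hx => ?_
  have hxV : x ∈ V := by
    by_contra h
    exact hx fun h' => absurd h' h
  obtain ⟨K, t, ht, hK⟩ := hf hxV
  rw [hV.nhdsWithin_eq hxV] at ht
  obtain ⟨u, hut, hu, hxu⟩ := mem_nhds_iff.1 ht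
  refine ⟨u ∩ _, inter_mem (mem_nhdsWithin_of_mem_nhds (hu.mem_nhds hxu)) self_mem_nhdsWithin, ?_⟩
  have h := (hK.mono hut).ae_differentiableWithinAt_of_mem (μ := μ)
  rw [ae_iff] at h
  refine measure_mono_null ?_ h
  intro y hy h'
  refine hy.2 fun _ => ?_
  exact (h' hy.1).differentiableAt (hu.mem_nhds hy.1)

section
open scoped Matrix.Norms.L2Operator

/-- A matrix map with differentiable entries is differentiable. -/
theorem Matrix.differentiableAt_of_entries {d : ℕ} {E : Type*} [NormedAddCommGroup E]
    [NormedSpace ℝ E] {F : E → Matrix (Fin d) (Fin d) ℝ} {x : E}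
    (h : ∀ j k, DifferentiableAt ℝ (fun y => F y j k) x) : DifferentiableAt ℝ F x := by
  have e : F = fun y => ∑ j, ∑ k, F y j k • Matrix.single j k (1 : ℝ) := by
    funext y
    conv_lhs => rw [Matrix.matrix_eq_sum_single (F y)]
    simp [Matrix.smul_single]
  rw [e]
  refine DifferentiableAt.fun_sum fun j _ => DifferentiableAt.fun_sum fun k _ => ?_
  exact (h j k).smul_const _

theorem Matrix.hasFDerivAt_entry {d : ℕ} {E : Type*} [NormedAddCommGroup E]
    [NormedSpace ℝ E] {F : E → Matrix (Fin d) (Fin d) ℝ} {G : E →L[ℝ] Matrix (Fin d) (Fin d) ℝ}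
    {x : E} (h : HasFDerivAt F G x) (j k : Fin d) :
    HasFDerivAt (fun y => F y j k)
      ((LinearMap.toContinuousLinearMap (Matrix.entryLinearMap ℝ ℝ j k)).comp G) x :=
  (LinearMap.toContinuousLinearMap (Matrix.entryLinearMap ℝ ℝ j k)).hasFDerivAt.comp x h

variable {n d : ℕ} {F : EuclideanSpace ℝ (Fin n) → Matrix (Fin d) (Fin d) ℝ}
  {G : EuclideanSpace ℝ (Fin n) →L[ℝ] Matrix (Fin d) (Fin d) ℝ} {x : EuclideanSpace ℝ (Fin n)}

theorem HasFDerivAt.matDifferentiableAt (h : HasFDerivAt F G x) : MatDifferentiableAt F x :=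
  fun j k => (Matrix.hasFDerivAt_entry h j k).differentiableAt

theorem HasFDerivAt.matPartial_eq (h : HasFDerivAt F G x) (i : Fin n) :
    matPartial i F x = G (EuclideanSpace.single i 1) := by
  ext j k
  exact ((Matrix.hasFDerivAt_entry h j k).hasLineDerivAt _).lineDeriv

end

/-! ### Frobenius products and the conclusion -/

/-- The Frobenius inner product of matrices is invariant under orthogonal conjugation. -/
theorem Matrix.sum_mul_unitary_conj {d : ℕ} (U : unitary (Matrix (Fin d) (Fin d) ℝ))
    (X Y : Matrix (Fin d) (Fin d) ℝ) :
    ∑ j, ∑ k, (star (U : Matrix (Fin d) (Fin d) ℝ) * X * U) j k *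
      (star (U : Matrix (Fin d) (Fin d) ℝ) * Y * U) j k = ∑ j, ∑ k, X j k * Y j k := by
  have h : ∀ X Y : Matrix (Fin d) (Fin d) ℝ,
      ∑ j, ∑ k, X j k * Y j k = (X * star Y).trace := fun X Y => by
    simp [Matrix.trace, Matrix.mul_apply]
  have hUU' : (U : Matrix (Fin d) (Fin d) ℝ) * star (U : Matrix (Fin d) (Fin d) ℝ) = 1 :=
    Unitary.coe_mul_star_self U
  rw [h, h, star_mul, star_mul, star_star, mul_assoc, Matrix.trace_mul_comm]
  simp only [mul_assoc]
  rw [← mul_assoc (U : Matrix (Fin d) (Fin d) ℝ) (star _), hUU', one_mul,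
    ← mul_assoc (U : Matrix (Fin d) (Fin d) ℝ) (star _), hUU', one_mul, Matrix.trace_mul_comm]

theorem theorem1p2 {n d : ℕ} (V : Set (EuclideanSpace ℝ (Fin n))) (hV : IsOpen V)
    (A : EuclideanSpace ℝ (Fin n) → Matrix (Fin d) (Fin d) ℝ)
    (hA : MatLocallyLipschitzOn V A) (hpos : ∀ x ∈ V, (A x).PosDef) :
    ∀ᵐ x ∂(volume.restrict V),
      (MatDifferentiableAt (fun y => matLog (A y)) x ∧
        ∀ s : ℝ, MatDifferentiableAt (fun y => matPow s (A y)) x) ∧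
      ∀ α β : ℝ,
        tensorInner (powDeriv α A x) (powDeriv β A x) ≥
          tensorNorm (powDeriv ((α + β) / 2) A x) ^ 2 := by
  -- The exceptional set depends on `A` only, so it serves all exponents at once.
  have hae : ∀ᵐ x ∂(volume.restrict V), ∀ j k, DifferentiableAt ℝ (fun y => A y j k) x :=
    ae_all_iff.2 fun j => ae_all_iff.2 fun k => (hA j k).ae_differentiableAt hV
  filter_upwards [hae, ae_restrict_mem hV.measurableSet] with x hd hxV
  have hx : (A x).IsHermitian := (hpos x hxV).1
  have hev : ∀ i, 0 < hx.eigenvalues i := (hpos x hxV).eigenvalues_pos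
  have hherm : ∀ᶠ y in 𝓝 x, (A y).IsHermitian := by
    filter_upwards [hV.mem_nhds hxV] with y hy using (hpos y hy).1
  have hF := (Matrix.differentiableAt_of_entries hd).hasFDerivAt
  obtain ⟨L, hL, hL'⟩ := Matrix.exists_hasFDerivAt_cfc hF hherm hx (f := Real.log)
    (f' := fun t => t⁻¹) fun i => Real.hasDerivAt_log (hev i).ne'
  have hP := fun s : ℝ => Matrix.exists_hasFDerivAt_cfc hF hherm hx (f := fun t => t ^ s)
    (f' := fun t => s * t ^ (s - 1)) fun i => Real.hasDerivAt_rpow_const (Or.inl (hev i).ne')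
  choose P hP hP' using hP
  refine ⟨⟨hL.matDifferentiableAt, fun s => (hP s).matDifferentiableAt⟩, fun α β => ?_⟩
  set U : Matrix (Fin d) (Fin d) ℝ := hx.eigenvectorUnitary.1 with hU
  have hD : ∀ s i j k, (star U * powDeriv s A x i * U) j k =
      powFactor s (hx.eigenvalues j) (hx.eigenvalues k) *
        (star U * fderiv ℝ A x (EuclideanSpace.single i 1) * U) j k := fun s i j k => by
    unfold powDeriv powFactor
    split_ifs with hs
    · rw [show matPartial i (fun y => matLog (A y)) x = _ from hL.matPartial_eq i, hL']
    · rw [show matPartial i (fun y => matPow s (A y)) x = _ from (hP s).matPartial_eq i,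
        Matrix.mul_smul, Matrix.smul_mul, Matrix.smul_apply, hP', smul_eq_mul,
        ← mul_assoc (s⁻¹)]
  -- All exponents share the same nonnegative weights, the squared entries of `∂ᵢA` in the
  -- eigenbasis.
  have hI : ∀ s t, tensorInner (powDeriv s A x) (powDeriv t A x) = ∑ i, ∑ j, ∑ k,
      powFactor s (hx.eigenvalues j) (hx.eigenvalues k) *
        powFactor t (hx.eigenvalues j) (hx.eigenvalues k) *
        (star U * fderiv ℝ A x (EuclideanSpace.single i 1) * U) j k ^ 2 := fun s t => by
    unfold tensorInner
    refine Finset.sum_congr rfl fun i _ => ?_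
    rw [← Matrix.sum_mul_unitary_conj hx.eigenvectorUnitary]
    refine Finset.sum_congr rfl fun j _ => Finset.sum_congr rfl fun k _ => ?_
    rw [← hU, hD, hD]
    ring
  have h0 : ∀ X : Fin n → Matrix (Fin d) (Fin d) ℝ, 0 ≤ tensorInner X X := fun X =>
    Finset.sum_nonneg fun i _ => Finset.sum_nonneg fun j _ => Finset.sum_nonneg fun k _ =>
      mul_self_nonneg _
  rw [ge_iff_le, tensorNorm, Real.sq_sqrt (h0 _), hI, hI]
  refine Finset.sum_le_sum fun i _ => Finset.sum_le_sum fun j _ => Finset.sum_le_sum fun k _ => ?_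
  refine mul_le_mul_of_nonneg_right ?_ (sq_nonneg _)
  rw [← sq]
  exact sq_powFactor_le α β (hev j) (hev k)
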